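/- Let $\mathcal{A}$ be a (skeletally small) abelian length category, that is, an abelian category in which every object has a composition series. A torsion class is a full subcategory of $\mathcal{A}$, closed under isomorphisms and containing $0$, that is closed under quotients and extensions; a wide subcategory is a full subcategory, closed under isomorphisms and containing $0$, that is closed under kernels, cokernels and extensions. Let $\mathsf{tors}\,\mathcal{A}$ be the complete lattice of torsion classes and $\mathsf{wide}\,\mathcal{A}$ the poset of wide subcategories, both ordered by inclusion, and for $\mathcal{W}\in\mathsf{wide}\,\mathcal{A}$ let $\mathsf{T}(\mathcal{W})$ be the smallest torsion class containing $\mathcal{W}$. For $L=\mathsf{tors}\,\mathcal{A}$ use the following notation. An element $j\in L$ is completely join-irreducible if $j=\bigvee X$ with $X\subseteq L$ implies $j\in X$; put $j_*=\bigvee\{x\in L\mid x<j\}$ and $\kappa(j)=\max\{x\in L\mid j\wedge x=j_*\}$ (for completely join-irreducible $j$ this maximum exists). For $a\le b$ in $L$ let $\mathrm{jlabel}[a,b]$ be the set of completely join-irreducible $j\in L$ with $j\le b$ and $\kappa(j)\ge a$. A canonical join representation of $x\in L$ is an expression $x=\bigvee A$, where $A\subseteq L$ is an antichain such that whenever $x=\bigvee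 B$ with $B\subseteq L$, each $a\in A$ satisfies $a\le b$ for some $b\in B$. Let $L_0$ be the set of $x\in L$ that have a canonical join representation. For $x\in L$ put $x_\downarrow=x\wedge\bigwedge\{x'\in L\mid x' \text{ is covered by } x\}$, and for $x,y\in L_0$ write $x\le_{\mathrm{clo}}y$ if $\mathrm{jlabel}[x_\downarrow,x]\subseteq\mathrm{jlabel}[y_\downarrow,y]$. Write $(\mathsf{tors}\,\mathcal{A})_{\mathrm{clo}}=(L_0,\le_{\mathrm{clo}})$. Then the map $\mathsf{T}\colon\mathsf{wide}\,\mathcal{A}\to\mathsf{tors}\,\mathcal{A}$ induces a poset isomorphism $\mathsf{wide}\,\mathcal{A}\xrightarrow{\ \sim\ }(\mathsf{tors}\,\mathcal{A})_{\mathrm{clo}}$: it takes values in $L_0$, is a bijection onto $L_0$, and $\mathcal{W}_1\subseteq\mathcal{W}_2$ if and only if $\mathsf{T}(\mathcal{W}_1)\le_{\mathrm{clo}}\mathsf{T}(\mathcal{W}_2)$. -/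

import Mathlib

open CategoryTheory CategoryTheory.Limits

universe v u

section LatticeTheory

variable {L : Type*} [CompleteLattice L]

/-- `j` is completely join-irreducible: `j = ⋁ X` implies `j ∈ X`. -/
def IsCompletelyJoinIrred (j : L) : Prop :=
  ∀ X : Set L, j = sSup X → j ∈ X

/-- `a_* = ⋁ {x | x < a}`. -/
def lowerStar (a : L) : L := sSup {x | x < a}

/-- The kappa map `κ(j) = max {x | j ⊓ x = j_*}`. It is written as a supremum so as to be total;
whether it is a maximum is the content of `IsGreatest {x | j ⊓ x = lowerStar j} (kappa j)`. -/
def kappa (j : L) : L := sSup {x | j ⊓ x = lowerStar j}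

/-- `jlabel [a, b]`, the set of completely join-irreducible `j` with `j ≤ b` and `κ(j) ≥ a`. -/
def jlabel (a b : L) : Set L :=
  {j | IsCompletelyJoinIrred j ∧ j ≤ b ∧ a ≤ kappa j}

/-- `x = ⋁ A` is the canonical join representation of `x`: it refines every join representation
of `x`, and `A` is an antichain. -/
structure IsCanonicalJoinRep (A : Set L) (x : L) : Prop where
  sSup_eq : sSup A = x
  refines : ∀ B : Set L, sSup B = x → ∀ a ∈ A, ∃ b ∈ B, a ≤ b
  antichain : ∀ a₁ ∈ A, ∀ a₂ ∈ A, a₁ ≤ a₂ → a₁ = a₂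

variable (L) in
/-- `L₀`, the set of elements of `L` that have a canonical join representation. -/
def CJRElements : Type _ := {x : L // ∃ A : Set L, IsCanonicalJoinRep A x}

/-- `x_↓`, the meet of `x` and all elements covered by `x`. -/
def lowerCore (x : L) : L := x ⊓ sInf {x' | x' ⋖ x}

/-- The core label order on `L₀`: `jlabel [x_↓, x] ⊆ jlabel [y_↓, y]`. -/
def cloLE (x y : CJRElements L) : Prop :=
  jlabel (lowerCore x.1) x.1 ⊆ jlabel (lowerCore y.1) y.1

end LatticeTheory

section AbelianCategories

open scoped ZeroObject

variable (C : Type u) [Category.{v} C] [Abelian C]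

variable {C} in
/-- `X` has a composition series `0 = X₀ ⊆ X₁ ⊆ ⋯ ⊆ Xₙ = X` with all `Xᵢ / Xᵢ₋₁` simple
(the series is built up from the bottom, one short exact sequence for each step). -/
inductive HasCompositionSeries : C → Prop
  | zero (X : C) (hX : IsZero X) : HasCompositionSeries X
  | step (S : ShortComplex C) (hS : S.ShortExact) (h₁ : HasCompositionSeries S.X₁)
      (h₃ : Simple S.X₃) : HasCompositionSeries S.X₂

/-- A torsion class: a full subcategory, closed under isomorphisms, that contains zero and is
closed under quotients and extensions (closure under isomorphisms is part of closure under
quotients, as isomorphisms are epimorphisms). -/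
structure TorsionClass where
  obj : ObjectProperty C
  containsZero : obj.ContainsZero
  closedUnderQuotients : obj.IsClosedUnderQuotients
  closedUnderExtensions : obj.IsClosedUnderExtensions

/-- A wide subcategory: a full subcategory, closed under isomorphisms, that contains zero and is
closed under kernels, cokernels and extensions. -/
structure WideSubcat where
  obj : ObjectProperty C
  closedUnderIsomorphisms : obj.IsClosedUnderIsomorphisms
  containsZero : obj.ContainsZero
  closedUnderKernels : obj.IsClosedUnderKernels
  closedUnderCokernels : obj.IsClosedUnderCokernels
  closedUnderExtensions : obj.IsClosedUnderExtensions

variable {C}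

theorem TorsionClass.obj_injective :
    Function.Injective (TorsionClass.obj : TorsionClass C → ObjectProperty C) := by
  rintro ⟨P, _, _, _⟩ ⟨Q, _, _, _⟩ h
  cases h
  rfl

theorem WideSubcat.obj_injective :
    Function.Injective (WideSubcat.obj : WideSubcat C → ObjectProperty C) := by
  rintro ⟨P, _, _, _, _, _⟩ ⟨Q, _, _, _, _, _⟩ h
  cases h
  rfl

/-- Torsion classes are ordered by inclusion. -/
instance : PartialOrder (TorsionClass C) :=
  PartialOrder.lift TorsionClass.obj TorsionClass.obj_injective

/-- Wide subcategories are ordered by inclusion. -/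
instance : PartialOrder (WideSubcat C) :=
  PartialOrder.lift WideSubcat.obj WideSubcat.obj_injective

/-- The infimum of a set of torsion classes is their intersection. -/
instance : InfSet (TorsionClass C) where
  sInf 𝒳 :=
    { obj := fun X => ∀ T ∈ 𝒳, T.obj X
      containsZero := ⟨0, isZero_zero C, fun T _ => by
        have := T.containsZero
        have := T.closedUnderQuotients
        exact T.obj.prop_zero⟩
      closedUnderQuotients := ⟨fun f _ hX T hT =>
        T.closedUnderQuotients.prop_of_epi f (hX T hT)⟩
      closedUnderExtensions := ⟨fun hS h₁ h₃ T hT =>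
        T.closedUnderExtensions.prop_X₂_of_shortExact hS (h₁ T hT) (h₃ T hT)⟩ }

theorem TorsionClass.isGLB_sInf (𝒳 : Set (TorsionClass C)) : IsGLB 𝒳 (sInf 𝒳) :=
  ⟨fun _ hT _ hX => hX _ hT, fun _ hU _ hX _ hT => hU hT _ hX⟩

/-- The complete lattice of torsion classes. -/
instance : CompleteLattice (TorsionClass C) :=
  completeLatticeOfInf (TorsionClass C) TorsionClass.isGLB_sInf

/-- `T(P)`, the smallest torsion class containing `P`. -/
def torsionClosure (P : ObjectProperty C) : TorsionClass C :=
  sInf {T | P ≤ T.obj}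

end AbelianCategories

/-!
Both sides of the isomorphism are parametrized by semibricks, i.e. families of pairwise
Hom-orthogonal bricks.

Sending a brick `B` to `T(B)` yields exactly the completely join-irreducible torsion classes, and
`κ(T(B)) = ⊥B`. If `S` is a semibrick, every nonzero morphism from an object of `T(S)` to a member
of `S` is an epimorphism. Hence a torsion class below `T(S)` that misses `B ∈ S` lies in `⊥B`, so
`T(S) = ⋁ {T(B) | B ∈ S}` is a canonical join representation, the elements covered by `T(S)` are
the `T(S) ∩ ⊥B`, and `T(S)_↓ = T(S) ∩ ⊥S`. Conversely, the joinands of a canonical join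
representation come from Hom-orthogonal bricks.

The relatively simple objects of a wide subcategory `W` form a semibrick `S` whose extension
closure is `W`, so `T(W) = T(S)`. The category `W` is recovered from `T(W)` as the wide
subcategory of Ingalls and Thomas, which is also `T(W) ∩ (T(W)_↓)^⊥`. In terms of bricks the
latter says that `T(B)` belongs to `jlabel [T(W)_↓, T(W)]` if and only if `B` belongs to `W`.
-/

section JoinIrreducibles

variable {L : Type*} [CompleteLattice L] {j m : L}

theorem lowerStar_eq_of_isGreatest (h : IsGreatest (Set.Iio j) m) : lowerStar j = m :=
  h.isLUB.sSup_eq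

theorem isCompletelyJoinIrred_of_isGreatest (h : IsGreatest (Set.Iio j) m) :
    IsCompletelyJoinIrred j := by
  intro X hX
  by_contra hj
  have hXm : sSup X ≤ m :=
    sSup_le fun x hx => h.2 ((hX ▸ le_sSup hx : x ≤ j).lt_of_ne (by rintro rfl; exact hj hx))
  exact h.1.not_ge (hX.le.trans hXm)

theorem lowerStar_le (j : L) : lowerStar j ≤ j :=
  sSup_le fun _ hx => le_of_lt hx

theorem IsCompletelyJoinIrred.lowerStar_lt (hj : IsCompletelyJoinIrred j) : lowerStar j < j :=
  (lowerStar_le j).lt_of_ne fun h => lt_irrefl j (hj {x | x < j} h.symm)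

namespace IsCanonicalJoinRep

variable {A : Set L} {a x : L}

theorem isCompletelyJoinIrred (h : IsCanonicalJoinRep A x) (ha : a ∈ A) :
    IsCompletelyJoinIrred a := by
  intro X hX
  have hx : sSup (A \ {a} ∪ X) = x := by
    rw [sSup_union, ← hX, ← h.sSup_eq, sup_comm, ← sSup_insert, Set.insert_sdiff_singleton,
      Set.insert_eq_of_mem ha]
  obtain ⟨b, ⟨hb, hba⟩ | hb, hab⟩ := h.refines _ hx a ha
  · exact absurd (h.antichain a ha b hb hab).symm hba
  · have : b ≤ a := hX ▸ le_sSup hb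
    rwa [le_antisymm hab this]

theorem not_le_sSup_insert_lowerStar (h : IsCanonicalJoinRep A x) (ha : a ∈ A) :
    ¬a ≤ sSup (insert (lowerStar a) (A \ {a})) := by
  intro hle
  have hx : sSup (insert (lowerStar a) (A \ {a})) = x := by
    rw [← sup_eq_right.2 hle, ← sSup_insert, Set.insert_comm, Set.insert_sdiff_singleton,
      Set.insert_eq_of_mem ha, sSup_insert, h.sSup_eq]
    exact sup_eq_right.2 ((lowerStar_le a).trans (h.sSup_eq ▸ le_sSup ha))
  obtain ⟨b, rfl | ⟨hb, hba⟩, hab⟩ := h.refines _ hx a ha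
  · exact (h.isCompletelyJoinIrred ha).lowerStar_lt.not_ge hab
  · exact hba (h.antichain a ha b hb hab).symm

end IsCanonicalJoinRep

end JoinIrreducibles

section ChainConditions

section ProperSubobjects

variable {C : Type u} [Category.{v} C]

/-- `Y` is isomorphic to a proper subobject of `X`. Induction along this relation replaces
induction on the length of an object. -/
def IsProperSubobject (Y X : C) : Prop := ∃ i : Y ⟶ X, Mono i ∧ ¬IsIso i

theorem mk_comp_lt_mk {X Y Z : C} (j : Z ⟶ Y) [Mono j] (i : Y ⟶ X) [Mono i]
    (hj : ¬IsIso j) : Subobject.mk (j ≫ i) < Subobject.mk i := by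
  refine lt_of_le_not_ge (Subobject.mk_le_mk_of_comm j rfl) fun h => hj ?_
  refine ⟨Subobject.ofMkLEMk i (j ≫ i) h, ?_, ?_⟩
  · simp [← cancel_mono (j ≫ i)]
  · simp [← cancel_mono i]

variable (C) in
theorem wellFounded_isProperSubobject [∀ X : C, IsArtinianObject X] :
    WellFounded (IsProperSubobject (C := C)) := by
  refine ⟨fun X => ?_⟩
  suffices h : ∀ (A : Subobject X) (Y : C) (i : Y ⟶ X) (_ : Mono i), Subobject.mk i = A →
      Acc IsProperSubobject Y from h _ X (𝟙 X) inferInstance rfl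
  intro A
  induction A using WellFoundedLT.induction with
  | _ A ih =>
    rintro Y i _ rfl
    exact ⟨_, fun Z ⟨j, _, hj⟩ => ih _ (mk_comp_lt_mk j i hj) Z (j ≫ i) inferInstance rfl⟩

end ProperSubobjects

variable {C : Type u} [Category.{v} C] [Abelian C]

theorem kernelSubobject_lt_comp {X Y Z : C} (p : X ⟶ Y) [Epi p] (q : Y ⟶ Z) [Epi q]
    (hq : ¬IsIso q) : kernelSubobject p < kernelSubobject (p ≫ q) := by
  refine lt_of_le_not_ge (kernelSubobject_comp_le p q) fun h => hq ?_
  have : Mono q := Preadditive.mono_of_cancel_zero _ fun {W} w hw => by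
    obtain ⟨W', π, _, x, hx⟩ := surjective_up_to_refinements_of_epi p w
    have hxp : x ≫ p = 0 := by
      rw [← kernelSubobject_factors_iff]
      refine Subobject.factors_of_le _ h ((kernelSubobject_factors_iff ..).2 ?_)
      rw [← Category.assoc, ← hx, Category.assoc, hw, comp_zero]
    rw [← cancel_epi π, hx, hxp, comp_zero]
  exact isIso_of_mono_of_epi q

section Extensions

variable {S : ShortComplex C}

theorem le_of_pullback_le_of_image_le (hS : S.Exact) [Mono S.f] {A B : Subobject S.X₂}
    (hAB : A ≤ B) (hf : (Subobject.pullback S.f).obj B ≤ (Subobject.pullback S.f).obj A)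
    (hg : imageSubobject (B.arrow ≫ S.g) ≤ imageSubobject (A.arrow ≫ S.g)) : B ≤ A := by
  have : Epi (Subobject.ofLE A B hAB) := by
    rw [epi_iff_surjective_up_to_refinements]
    intro Z b
    -- Locally `b` agrees with some `a` in `A` after applying `S.g`, and then `b - a` comes from
    -- `B ∩ S.X₁ = A ∩ S.X₁`.
    obtain ⟨Z₁, π₁, _, a, ha⟩ := surjective_up_to_refinements_of_epi
      (factorThruImageSubobject (A.arrow ≫ S.g))
      (b ≫ factorThruImageSubobject (B.arrow ≫ S.g) ≫ Subobject.ofLE _ _ hg)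
    have hag : (π₁ ≫ b ≫ B.arrow - a ≫ A.arrow) ≫ S.g = 0 := by
      have := ha =≫ (imageSubobject (A.arrow ≫ S.g)).arrow
      simp only [Category.assoc, Subobject.ofLE_arrow, imageSubobject_arrow_comp] at this
      simp [Preadditive.sub_comp, this]
    obtain ⟨Z₂, π₂, _, k, hk⟩ := hS.exact_up_to_refinements _ hag
    have hkB : B.Factors (k ≫ S.f) := by
      have : k ≫ S.f = (π₂ ≫ π₁ ≫ b - π₂ ≫ a ≫ Subobject.ofLE A B hAB) ≫ B.arrow := by
        simp [← hk, Preadditive.sub_comp]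
      exact this ▸ Subobject.factors_comp_arrow _
    have hkA : A.Factors (k ≫ S.f) :=
      (pullback_factors_iff ..).1
        (Subobject.factors_of_le k hf ((pullback_factors_iff ..).2 hkB))
    refine ⟨Z₂, π₂ ≫ π₁, inferInstance, A.factorThru _ hkA + π₂ ≫ a, ?_⟩
    simp [← cancel_mono B.arrow, Preadditive.add_comp, ← hk]
  have := isIso_of_mono_of_epi (Subobject.ofLE A B hAB)
  exact Subobject.le_of_comm (inv (Subobject.ofLE A B hAB)) (by simp)

theorem strictMono_pullback_image (hS : S.Exact) [Mono S.f] :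
    StrictMono fun A : Subobject S.X₂ =>
      ((Subobject.pullback S.f).obj A, imageSubobject (A.arrow ≫ S.g)) := by
  intro A B hAB
  have himage : imageSubobject (A.arrow ≫ S.g) ≤ imageSubobject (B.arrow ≫ S.g) := by
    rw [← Subobject.ofLE_arrow hAB.le, Category.assoc]
    exact imageSubobject_comp_le _ _
  refine lt_of_le_not_ge ⟨(Subobject.pullback S.f).monotone hAB.le, himage⟩ fun h => ?_
  exact hAB.not_ge (le_of_pullback_le_of_image_le hS hAB.le h.1 h.2)

end Extensions

instance : (isNoetherianObject (C := C)).IsClosedUnderExtensions where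
  prop_X₂_of_shortExact {S} hS h₁ h₃ := by
    have := hS.mono_f
    have : WellFoundedGT (Subobject S.X₁) := h₁
    have : WellFoundedGT (Subobject S.X₃) := h₃
    exact (strictMono_pullback_image hS.exact).wellFoundedGT

instance : (isArtinianObject (C := C)).IsClosedUnderExtensions where
  prop_X₂_of_shortExact {S} hS h₁ h₃ := by
    have := hS.mono_f
    have : WellFoundedLT (Subobject S.X₁) := h₁
    have : WellFoundedLT (Subobject S.X₃) := h₃
    exact (strictMono_pullback_image hS.exact).wellFoundedLT

theorem HasCompositionSeries.prop {P : ObjectProperty C} [P.ContainsZero]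
    [P.IsClosedUnderIsomorphisms] [P.IsClosedUnderExtensions] (hP : ∀ X, Simple X → P X) {X : C}
    (h : HasCompositionSeries X) : P X := by
  induction h with
  | zero X hX => exact P.prop_of_isZero hX
  | step S hS _ h₃ ih => exact P.prop_X₂_of_shortExact hS ih (hP _ h₃)

open scoped IsSimpleOrder in
theorem HasCompositionSeries.isNoetherianObject {X : C} (h : HasCompositionSeries X) :
    IsNoetherianObject X :=
  ⟨h.prop (P := CategoryTheory.isNoetherianObject) fun X _ =>
    Finite.to_wellFoundedGT (α := Subobject X)⟩

open scoped IsSimpleOrder in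
theorem HasCompositionSeries.isArtinianObject {X : C} (h : HasCompositionSeries X) :
    IsArtinianObject X :=
  ⟨h.prop (P := CategoryTheory.isArtinianObject) fun X _ =>
    Finite.to_wellFoundedLT (α := Subobject X)⟩

/-- `Q` is isomorphic to a proper quotient of `X`, i.e. to `X / K` with `K ≠ 0`; the dual of
`IsProperSubobject`. -/
def IsProperQuotient (Q X : C) : Prop := ∃ p : X ⟶ Q, Epi p ∧ ¬IsIso p

variable (C) in
theorem wellFounded_isProperQuotient [∀ X : C, IsNoetherianObject X] :
    WellFounded (IsProperQuotient (C := C)) := by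
  refine ⟨fun X => ?_⟩
  suffices h : ∀ (K : Subobject X) (Q : C) (p : X ⟶ Q), Epi p → kernelSubobject p = K →
      Acc IsProperQuotient Q from h _ X (𝟙 X) inferInstance rfl
  intro K
  induction K using WellFoundedGT.induction with
  | _ K ih =>
    rintro Q p _ rfl
    exact ⟨_, fun Q' ⟨q, _, hq⟩ =>
      ih _ (kernelSubobject_lt_comp p q hq) Q' (p ≫ q) inferInstance rfl⟩

theorem isProperQuotient_cokernel {X Y : C} {f : X ⟶ Y} (hf : f ≠ 0) :
    IsProperQuotient (cokernel f) Y :=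
  ⟨cokernel.π f, inferInstance, fun _ => hf (by
    rw [← cancel_mono (cokernel.π f), cokernel.condition, zero_comp])⟩

theorem isProperSubobject_kernel {X Y : C} {f : X ⟶ Y} (hf : f ≠ 0) :
    IsProperSubobject (kernel f) X :=
  ⟨kernel.ι f, inferInstance, fun _ => hf (by
    rw [← cancel_epi (kernel.ι f), kernel.condition, comp_zero])⟩

theorem isIso_of_epi_endo [∀ X : C, IsNoetherianObject X] {X : C} (f : X ⟶ X) [Epi f] :
    IsIso f := by
  by_contra hf
  exact (wellFounded_isProperQuotient C).irrefl.irrefl X ⟨f, inferInstance, hf⟩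

end ChainConditions

section ExactSequences

variable {C : Type u} [Category.{v} C] [Abelian C]

theorem not_isZero_image {X Y : C} {f : X ⟶ Y} (hf : f ≠ 0) : ¬IsZero (Abelian.image f) :=
  fun h => hf (by rw [← Abelian.image.fac f, h.eq_of_src (Abelian.image.ι f) 0, comp_zero])

/-- The kernel of `f` computed inside the kernel of `f ≫ g`: it reduces kernels of morphisms to
an extension to kernels of morphisms to its two ends. -/
noncomputable def kernelKernelCompIso {X Y Z : C} (f : X ⟶ Y) (g : Y ⟶ Z) :
    kernel (kernel.ι (f ≫ g) ≫ f) ≅ kernel f where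
  hom := kernel.lift _ (kernel.ι _ ≫ kernel.ι _) (by simp only [Category.assoc, kernel.condition])
  inv := kernel.lift _ (kernel.lift _ (kernel.ι f) (by simp)) (by simp)
  hom_inv_id := by simp [← cancel_mono (kernel.ι _)]
  inv_hom_id := by simp [← cancel_mono (kernel.ι _)]

theorem exact_of_isPushout {S : ShortComplex C} (hS : S.Exact) {F Y : C} {q : S.X₁ ⟶ F}
    {l : S.X₂ ⟶ Y} {r : F ⟶ Y} (sq : IsPushout S.f q l r) {g : Y ⟶ S.X₃} (hl : l ≫ g = S.g)
    (hr : r ≫ g = 0) : (ShortComplex.mk r g hr).Exact := by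
  rw [ShortComplex.exact_iff_exact_up_to_refinements]
  intro Z y hy
  dsimp only at y hy ⊢
  obtain ⟨Z₁, π₁, _, x, z, hxz⟩ := sq.hom_eq_add_up_to_refinements y
  have hx : x ≫ S.g = 0 := by simpa [hy, hl, hr] using (hxz =≫ g).symm
  obtain ⟨Z₂, π₂, _, k, hk⟩ := hS.exact_up_to_refinements x hx
  refine ⟨Z₂, π₂ ≫ π₁, inferInstance, k ≫ q + π₂ ≫ z, ?_⟩
  simp [hxz, reassoc_of% hk, sq.w, Preadditive.add_comp]

theorem exists_retraction {S : ShortComplex C} (hS : S.Exact) [Mono S.f] {Z : C}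
    (s : Z ⟶ S.X₂) [IsIso (s ≫ S.g)] : ∃ r, S.f ≫ r = 𝟙 S.X₁ := by
  refine ⟨hS.lift (𝟙 _ - S.g ≫ inv (s ≫ S.g) ≫ s) (by simp [Preadditive.sub_comp]), ?_⟩
  rw [← cancel_mono S.f, Category.assoc, hS.lift_f]
  simp [Preadditive.comp_sub]

end ExactSequences

section ClosureProperties

variable {C : Type u} [Category.{v} C] [Abelian C] {P : ObjectProperty C}

instance : P.leftOrthogonal.IsClosedUnderQuotients where
  prop_of_epi p _ h Y f hY := by rw [← cancel_epi p, h (p ≫ f) hY, comp_zero]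

instance : P.leftOrthogonal.IsClosedUnderExtensions where
  prop_X₂_of_shortExact {S} hS h₁ h₃ Y f hY := by
    have := hS.epi_g
    have hf : S.f ≫ f = 0 := h₁ _ hY
    have hdesc : hS.exact.desc f hf = 0 := h₃ _ hY
    rw [← hS.exact.g_desc f hf, hdesc, comp_zero]

instance : P.rightOrthogonal.IsClosedUnderExtensions where
  prop_X₂_of_shortExact {S} hS h₁ h₃ X f hX := by
    have := hS.mono_f
    have hf : f ≫ S.g = 0 := h₃ _ hX
    have hlift : hS.exact.lift f hf = 0 := h₁ _ hX
    rw [← hS.exact.lift_f f hf, hlift, zero_comp]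

theorem prop_of_epi_of_kernel [P.IsClosedUnderExtensions] {X Q : C} (p : X ⟶ Q) [Epi p]
    (hK : P (kernel p)) (hQ : P Q) : P X :=
  P.prop_X₂_of_shortExact (S := ShortComplex.mk (kernel.ι p) p (kernel.condition p))
    { exact := ShortComplex.exact_kernel p } hK hQ

theorem prop_of_mono_of_cokernel [P.IsClosedUnderExtensions] {A X : C} (i : A ⟶ X) [Mono i]
    (hA : P A) (hX : P (cokernel i)) : P X :=
  P.prop_X₂_of_shortExact (S := ShortComplex.mk i (cokernel.π i) (cokernel.condition i))
    { exact := ShortComplex.exact_cokernel i } hA hX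

theorem prop_kernel_iff_of_comp_mono [P.IsClosedUnderIsomorphisms] {X Y Z : C} {f : X ⟶ Y}
    {h : X ⟶ Z} (g : Y ⟶ Z) [Mono g] (w : f ≫ g = h) : P (kernel h) ↔ P (kernel f) := by
  subst w
  exact P.prop_iff_of_iso (kernelCompMono f g)

theorem prop_kernel_iff_of_isPullback [P.IsClosedUnderIsomorphisms] {W X Y Z : C}
    {t : W ⟶ X} {l : W ⟶ Y} {r : X ⟶ Z} {b : Y ⟶ Z} (sq : IsPullback t l r b) :
    P (kernel t) ↔ P (kernel b) :=
  have := isIso_kernel_map_of_isPullback sq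
  P.prop_iff_of_iso (asIso (kernel.map _ _ _ _ sq.w))

theorem le_of_forall_exists_mono [∀ X : C, IsNoetherianObject X] {Q : ObjectProperty C}
    [P.ContainsZero] [P.IsClosedUnderIsomorphisms] [P.IsClosedUnderExtensions]
    (h : ∀ X, Q X → ¬IsZero X →
      ∃ (B : C) (i : B ⟶ X), Mono i ∧ ¬IsZero B ∧ P B ∧ Q (cokernel i)) : Q ≤ P := by
  intro X hX
  induction X using (wellFounded_isProperQuotient C).induction with
  | _ X ih =>
    by_cases h0 : IsZero X
    · exact P.prop_of_isZero h0
    obtain ⟨B, i, _, hB0, hB, hQ⟩ := h X hX h0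
    have hi : i ≠ 0 := fun hi => hB0 (IsZero.of_mono_eq_zero i hi)
    exact prop_of_mono_of_cokernel i hB (ih _ (isProperQuotient_cokernel hi) hQ)

end ClosureProperties

section TorsionClasses

variable {C : Type u} [Category.{v} C] [Abelian C] {P : ObjectProperty C}

namespace TorsionClass

instance (T : TorsionClass C) : T.obj.ContainsZero := T.containsZero
instance (T : TorsionClass C) : T.obj.IsClosedUnderQuotients := T.closedUnderQuotients
instance (T : TorsionClass C) : T.obj.IsClosedUnderExtensions := T.closedUnderExtensions

theorem image_mem (T : TorsionClass C) {X Y : C} (f : X ⟶ Y) (hX : T.obj X) :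
    T.obj (Abelian.image f) :=
  T.obj.prop_of_epi (Abelian.factorThruImage f) hX

theorem mem_inf {T U : TorsionClass C} {X : C} : (T ⊓ U).obj X ↔ T.obj X ∧ U.obj X := by
  refine ⟨fun h => ⟨(inf_le_left : T ⊓ U ≤ T) X h, (inf_le_right : T ⊓ U ≤ U) X h⟩, fun h => ?_⟩
  have : sInf {T, U} ≤ T ⊓ U := le_inf (sInf_le (by simp)) (sInf_le (by simp))
  refine this X ?_
  rintro V (rfl | rfl)
  exacts [h.1, h.2]

/-- The left perpendicular torsion class of `P`: the objects without nonzero morphisms to objects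
of `P`. -/
def perp (P : ObjectProperty C) : TorsionClass C where
  obj := P.leftOrthogonal
  containsZero := inferInstance
  closedUnderQuotients := inferInstance
  closedUnderExtensions := inferInstance

theorem le_perp_iff {T : TorsionClass C} : T ≤ perp P ↔ P ≤ T.obj.rightOrthogonal :=
  ⟨fun h _ hY _ f hX => h _ hX f hY, fun h _ hX _ f hY => h _ hY f hX⟩

theorem mem_perp_singleton {X Y : C} :
    (perp (.singleton Y)).obj X ↔ ∀ f : X ⟶ Y, f = 0 := by
  refine ⟨fun h f => h f (by simp), fun h Z f hZ => ?_⟩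
  obtain rfl := (ObjectProperty.singleton_iff ..).1 hZ
  exact h f

theorem le_perp_singleton_iff {T : TorsionClass C} {Y : C} :
    T ≤ perp (.singleton Y) ↔ T.obj.rightOrthogonal Y :=
  le_perp_iff.trans (ObjectProperty.singleton_le_iff ..)

theorem leftOrthogonal_rightOrthogonal_le [∀ X : C, IsNoetherianObject X] (T : TorsionClass C) :
    T.obj.rightOrthogonal.leftOrthogonal ≤ T.obj := by
  refine le_of_forall_exists_mono fun X hX h0 => ?_
  obtain ⟨Z, f, hZ, hf⟩ : ∃ (Z : C) (f : Z ⟶ X), T.obj Z ∧ f ≠ 0 := by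
    by_contra! h
    exact h0 ((IsZero.iff_id_eq_zero X).2 (hX (𝟙 X) h))
  exact ⟨_, Abelian.image.ι f, inferInstance, not_isZero_image hf, T.image_mem f hZ,
    T.obj.rightOrthogonal.leftOrthogonal.prop_of_epi (cokernel.π _) hX⟩

theorem le_of_rightOrthogonal_le [∀ X : C, IsNoetherianObject X] {T U : TorsionClass C}
    (h : U.obj.rightOrthogonal ≤ T.obj.rightOrthogonal) : T ≤ U :=
  fun _ hX => U.leftOrthogonal_rightOrthogonal_le _ fun _ f hY => h _ hY f hX

/-- `T(B)`, the smallest torsion class containing the object `B`. For `B` a brick these are the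
completely join-irreducible torsion classes. -/
def gen (B : C) : TorsionClass C := torsionClosure (.singleton B)

end TorsionClass

open TorsionClass

theorem torsionClosure_le {T : TorsionClass C} : torsionClosure P ≤ T ↔ P ≤ T.obj :=
  ⟨fun h X hX => h X fun _ hU => hU X hX, fun h => sInf_le h⟩

theorem le_torsionClosure (P : ObjectProperty C) : P ≤ (torsionClosure P).obj :=
  torsionClosure_le.1 le_rfl

theorem TorsionClass.gen_le {B : C} {T : TorsionClass C} : gen B ≤ T ↔ T.obj B :=
  torsionClosure_le.trans (ObjectProperty.singleton_le_iff ..)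

theorem TorsionClass.mem_gen (B : C) : (gen B).obj B := gen_le.1 le_rfl

theorem sSup_gen_image (P : ObjectProperty C) : sSup (gen '' {B | P B}) = torsionClosure P := by
  refine le_antisymm (sSup_le ?_)
    (torsionClosure_le.2 fun B hB => gen_le.1 (le_sSup (Set.mem_image_of_mem gen hB)))
  rintro _ ⟨B, hB, rfl⟩
  exact gen_le.2 (le_torsionClosure P B hB)

theorem exists_ne_zero_of_mem_torsionClosure {Y : C} (hY : (torsionClosure P).obj Y)
    (h0 : ¬IsZero Y) : ∃ (X : C) (f : X ⟶ Y), P X ∧ f ≠ 0 := by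
  by_contra! h
  have hPY : torsionClosure P ≤ perp (.singleton Y) :=
    torsionClosure_le.2 fun X hX => mem_perp_singleton.2 fun f => h X f hX
  exact h0 ((IsZero.iff_id_eq_zero Y).2 (mem_perp_singleton.1 (hPY Y hY) (𝟙 Y)))

end TorsionClasses

section RelativelySimple

variable {C : Type u} [Category.{v} C] {P : ObjectProperty C}

/-- The simple objects relative to `P`: nonzero objects of `P` that have no proper nonzero
subobject in `P`. -/
def relativelySimple (P : ObjectProperty C) : ObjectProperty C := fun B =>
  P B ∧ ¬IsZero B ∧ ∀ ⦃V : C⦄ (i : V ⟶ B) [Mono i], P V → ¬IsZero V → IsIso i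

theorem exists_mono_relativelySimple [∀ X : C, IsArtinianObject X] {X : C} (hX : P X)
    (h0 : ¬IsZero X) : ∃ (B : C) (i : B ⟶ X), Mono i ∧ relativelySimple P B := by
  induction X using (wellFounded_isProperSubobject C).induction with
  | _ X ih =>
    by_cases hs : relativelySimple P X
    · exact ⟨X, 𝟙 X, inferInstance, hs⟩
    obtain ⟨V, i, _, hV, hV0, hi⟩ :
        ∃ (V : C) (i : V ⟶ X), Mono i ∧ P V ∧ ¬IsZero V ∧ ¬IsIso i := by
      by_contra! h
      exact hs ⟨hX, h0, fun V i hi hV hV0 => h V i hi hV hV0⟩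
    obtain ⟨B, j, _, hB⟩ := ih V ⟨i, inferInstance, hi⟩ hV hV0
    exact ⟨B, j ≫ i, inferInstance, hB⟩

end RelativelySimple

section Bricks

variable {C : Type u} [Category.{v} C] [Abelian C] {P S : ObjectProperty C}

open TorsionClass

/-- A brick: a nonzero object all of whose nonzero endomorphisms are invertible. -/
structure IsBrick (B : C) : Prop where
  not_isZero : ¬IsZero B
  isIso (f : B ⟶ B) : f ≠ 0 → IsIso f

/-- A semibrick: a class of pairwise Hom-orthogonal bricks. It need not be closed under
isomorphisms and may contain several copies of the same brick, hence the formulation in terms of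
nonzero morphisms. -/
structure IsSemibrick (S : ObjectProperty C) : Prop where
  not_isZero {X : C} : S X → ¬IsZero X
  isIso {X Y : C} (f : X ⟶ Y) : S X → S Y → f ≠ 0 → IsIso f

theorem IsSemibrick.isBrick (hS : IsSemibrick S) {B : C} (hB : S B) : IsBrick B :=
  ⟨hS.not_isZero hB, fun f => hS.isIso f hB hB⟩

theorem IsBrick.isSemibrick_singleton {B : C} (hB : IsBrick B) :
    IsSemibrick (ObjectProperty.singleton B) := by
  constructor
  · intro X hX
    obtain rfl := (ObjectProperty.singleton_iff ..).1 hX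
    exact hB.not_isZero
  · intro X Y f hX hY
    obtain rfl := (ObjectProperty.singleton_iff ..).1 hX
    obtain rfl := (ObjectProperty.singleton_iff ..).1 hY
    exact hB.isIso f

theorem isBrick_of_relativelySimple [∀ X : C, IsNoetherianObject X] [P.IsClosedUnderQuotients]
    {B : C} (hB : relativelySimple P B) : IsBrick B := by
  refine ⟨hB.2.1, fun f hf => ?_⟩
  have := hB.2.2 (Abelian.image.ι f) (P.prop_of_epi (Abelian.factorThruImage f) hB.1)
    (not_isZero_image hf)
  have : Epi f := Abelian.image.fac f ▸ epi_comp _ _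
  exact isIso_of_epi_endo f

theorem isSemibrick_relativelySimple [P.IsClosedUnderKernels] [P.IsClosedUnderCokernels] :
    IsSemibrick (relativelySimple P) := by
  refine ⟨fun hX => hX.2.1, fun {X Y} f hX hY hf => ?_⟩
  have := hY.2.2 (Abelian.image.ι f) (P.prop_kernel _ hY.1 (P.prop_cokernel f hX.1 hY.1))
    (not_isZero_image hf)
  have : Epi f := Abelian.image.fac f ▸ epi_comp _ _
  have : Mono f := by
    by_contra hm
    have := hX.2.2 (kernel.ι f) (P.prop_kernel f hX.1 hY.1) fun h =>
      hm (Preadditive.mono_of_kernel_zero (h.eq_of_src _ _))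
    exact hf (by rw [← cancel_epi (kernel.ι f), kernel.condition, comp_zero])
  exact isIso_of_mono_of_epi f

theorem IsSemibrick.epi_of_ne_zero (hS : IsSemibrick S) {X B : C}
    (hX : (torsionClosure S).obj X) (hB : S B) {f : X ⟶ B} (hf : f ≠ 0) : Epi f := by
  obtain ⟨B', g, hB', hg⟩ := exists_ne_zero_of_mem_torsionClosure
    ((torsionClosure S).image_mem f hX) (not_isZero_image hf)
  have hgι : g ≫ Abelian.image.ι f ≠ 0 := fun h => hg (zero_of_comp_mono _ h)
  have := hS.isIso _ hB' hB hgι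
  have : Epi (Abelian.image.ι f) := epi_of_epi g _
  exact Abelian.image.fac f ▸ epi_comp _ _

theorem IsSemibrick.le_perp_of_not_mem (hS : IsSemibrick S) {T : TorsionClass C}
    (hT : T ≤ torsionClosure S) {B : C} (hB : S B) (hTB : ¬T.obj B) :
    T ≤ perp (.singleton B) := by
  refine fun X hX => mem_perp_singleton.2 fun f => ?_
  by_contra hf
  have := hS.epi_of_ne_zero (hT X hX) hB hf
  exact hTB (T.obj.prop_of_epi f hX)

namespace IsBrick

variable {B B' : C}

theorem not_mem_perp (hB : IsBrick B) : ¬(perp (.singleton B)).obj B :=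
  fun h => hB.not_isZero ((IsZero.iff_id_eq_zero B).2 (mem_perp_singleton.1 h _))

theorem isGreatest_Iio_gen (hB : IsBrick B) :
    IsGreatest (Set.Iio (gen B)) (gen B ⊓ perp (.singleton B)) := by
  refine ⟨lt_of_le_not_ge inf_le_left fun h => hB.not_mem_perp (mem_inf.1 (gen_le.1 h)).2,
    fun T hT => le_inf hT.le ?_⟩
  exact hB.isSemibrick_singleton.le_perp_of_not_mem hT.le (by simp)
    fun hTB => hT.not_ge (gen_le.2 hTB)

theorem isCompletelyJoinIrred_gen (hB : IsBrick B) : IsCompletelyJoinIrred (gen B) :=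
  isCompletelyJoinIrred_of_isGreatest hB.isGreatest_Iio_gen

theorem lowerStar_gen (hB : IsBrick B) :
    lowerStar (gen B) = gen B ⊓ perp (.singleton B) :=
  lowerStar_eq_of_isGreatest hB.isGreatest_Iio_gen

theorem le_perp_of_lowerStar_le (hB : IsBrick B) {T : TorsionClass C}
    (hT : lowerStar (gen B) ≤ T) (hTB : ¬T.obj B) : T ≤ perp (.singleton B) := by
  refine fun X hX => mem_perp_singleton.2 fun f => ?_
  by_contra hf
  have hcok : (perp (.singleton B)).obj (cokernel f) := by
    refine mem_perp_singleton.2 fun g => ?_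
    by_contra hg
    have := hB.isIso (cokernel.π f ≫ g) fun h => hg (zero_of_epi_comp _ h)
    have : Mono (cokernel.π f) := mono_of_mono _ g
    exact hf (zero_of_comp_mono (cokernel.π f) (cokernel.condition f))
  have hQ : T.obj (cokernel f) := by
    rw [hB.lowerStar_gen] at hT
    exact hT _ (mem_inf.2 ⟨(gen B).obj.prop_of_epi (cokernel.π f) (mem_gen B), hcok⟩)
  exact hTB (prop_of_epi_of_kernel (cokernel.π f) (T.image_mem f hX) hQ)

theorem isGreatest_perp (hB : IsBrick B) :
    IsGreatest {T : TorsionClass C | gen B ⊓ T = lowerStar (gen B)} (perp (.singleton B)) := by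
  refine ⟨hB.lowerStar_gen.symm, fun T (hT : _ = _) => ?_⟩
  refine hB.le_perp_of_lowerStar_le (hT ▸ inf_le_right) fun hTB => ?_
  rw [inf_eq_left.2 (gen_le.2 hTB)] at hT
  exact hB.isCompletelyJoinIrred_gen.lowerStar_lt.ne hT.symm

theorem kappa_gen (hB : IsBrick B) : kappa (gen B) = perp (.singleton B) :=
  hB.isGreatest_perp.isLUB.sSup_eq

theorem isIso_of_gen_eq (hB : IsBrick B) (hB' : IsBrick B') (h : gen B = gen B') {f : B ⟶ B'}
    (hf : f ≠ 0) : IsIso f := by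
  have : Epi f :=
    hB'.isSemibrick_singleton.epi_of_ne_zero (h ▸ mem_gen B : (gen B').obj B) (by simp) hf
  obtain ⟨X, g, hX, hg⟩ :=
    exists_ne_zero_of_mem_torsionClosure (h ▸ mem_gen B : (gen B').obj B) hB.not_isZero
  obtain rfl := (ObjectProperty.singleton_iff ..).1 hX
  have := hB.isIso (f ≫ g) fun h => hg (zero_of_epi_comp f h)
  have : Mono f := mono_of_mono f g
  exact isIso_of_mono_of_epi f

end IsBrick

section Generation

variable [∀ X : C, IsNoetherianObject X] [∀ X : C, IsArtinianObject X]

theorem torsionClosure_isBrick_inf (T : TorsionClass C) :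
    torsionClosure (IsBrick ⊓ T.obj) = T := by
  refine le_antisymm (torsionClosure_le.2 inf_le_right)
    (le_of_rightOrthogonal_le fun Y hY X f hX => ?_)
  by_contra hf
  obtain ⟨B, i, _, hB⟩ := exists_mono_relativelySimple (T.image_mem f hX) (not_isZero_image hf)
  have hi : i ≫ Abelian.image.ι f = 0 :=
    hY _ (le_torsionClosure _ B ⟨isBrick_of_relativelySimple hB, hB.1⟩)
  exact hB.2.1 (IsZero.of_mono_eq_zero _ hi)

theorem IsCompletelyJoinIrred.exists_brick {j : TorsionClass C} (hj : IsCompletelyJoinIrred j) :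
    ∃ B, IsBrick B ∧ gen B = j := by
  obtain ⟨B, hB, h⟩ := hj (gen '' {B | IsBrick B ∧ j.obj B})
    ((torsionClosure_isBrick_inf j).symm.trans (sSup_gen_image _).symm)
  exact ⟨B, hB.1, h⟩

theorem IsCompletelyJoinIrred.isGreatest_kappa {j : TorsionClass C}
    (hj : IsCompletelyJoinIrred j) : IsGreatest {T | j ⊓ T = lowerStar j} (kappa j) := by
  obtain ⟨B, hB, rfl⟩ := hj.exists_brick
  exact hB.kappa_gen ▸ hB.isGreatest_perp

end Generation

end Bricks

section CanonicalJoins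

variable {C : Type u} [Category.{v} C] [Abelian C] {S : ObjectProperty C}

open TorsionClass

namespace IsSemibrick

theorem isCanonicalJoinRep (hS : IsSemibrick S) :
    IsCanonicalJoinRep (gen '' {B | S B}) (torsionClosure S) where
  sSup_eq := sSup_gen_image S
  refines := by
    rintro 𝒳 h𝒳 _ ⟨B, hB, rfl⟩
    by_contra! h
    have hle : sSup 𝒳 ≤ perp (.singleton B) := sSup_le fun T hT =>
      hS.le_perp_of_not_mem (h𝒳 ▸ le_sSup hT) hB fun hTB => h T hT (gen_le.2 hTB)
    exact (hS.isBrick hB).not_mem_perp (hle B (h𝒳 ▸ le_torsionClosure S B hB))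
  antichain := by
    rintro _ ⟨B, hB, rfl⟩ _ ⟨B', hB', rfl⟩ h
    obtain ⟨X, f, hX, hf⟩ :=
      exists_ne_zero_of_mem_torsionClosure (gen_le.1 h) (hS.not_isZero hB)
    obtain rfl := (ObjectProperty.singleton_iff ..).1 hX
    have := hS.isIso f hB' hB hf
    exact le_antisymm h (gen_le.2 ((gen B).obj.prop_of_iso (asIso f).symm (mem_gen B)))

theorem inf_perp_covBy (hS : IsSemibrick S) {B : C} (hB : S B) :
    torsionClosure S ⊓ perp (.singleton B) ⋖ torsionClosure S := by
  refine ⟨lt_of_le_not_ge inf_le_left fun h => (hS.isBrick hB).not_mem_perp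
    (mem_inf.1 (h B (le_torsionClosure S B hB))).2, fun T hlt hT => hT.not_ge ?_⟩
  have hTB : T.obj B := by
    by_contra hTB
    exact hlt.not_ge (le_inf hT.le (hS.le_perp_of_not_mem hT.le hB hTB))
  refine torsionClosure_le.2 fun B' hB' => ?_
  by_cases h : ∀ f : B' ⟶ B, f = 0
  · exact hlt.le B' (mem_inf.2 ⟨le_torsionClosure S B' hB', mem_perp_singleton.2 h⟩)
  · push Not at h
    obtain ⟨f, hf⟩ := h
    have := hS.isIso f hB' hB hf
    exact T.obj.prop_of_iso (asIso f).symm hTB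

theorem lowerCore_torsionClosure (hS : IsSemibrick S) :
    lowerCore (torsionClosure S) = torsionClosure S ⊓ perp S := by
  refine le_antisymm (le_inf inf_le_left (le_perp_iff.2 fun B hB => ?_))
    (le_inf inf_le_left (le_sInf fun T hT => ?_))
  · have hle : lowerCore (torsionClosure S) ≤ torsionClosure S ⊓ perp (.singleton B) :=
      inf_le_right.trans (sInf_le (hS.inf_perp_covBy hB))
    exact le_perp_singleton_iff.1 (hle.trans inf_le_right)
  · obtain ⟨B, hB, hTB⟩ : ∃ B, S B ∧ ¬T.obj B := by
      by_contra! h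
      exact hT.lt.not_ge (torsionClosure_le.2 h)
    have hTle : T ≤ torsionClosure S ⊓ perp (.singleton B) :=
      le_inf hT.le (hS.le_perp_of_not_mem hT.le hB hTB)
    have hTeq : torsionClosure S ⊓ perp (.singleton B) = T :=
      (hT.eq_or_eq hTle inf_le_left).resolve_right (hS.inf_perp_covBy hB).ne
    rw [← hTeq]
    exact inf_le_inf_left _ (le_perp_singleton_iff.2 (le_perp_iff.1 le_rfl _ hB))

end IsSemibrick

namespace IsCanonicalJoinRep

variable {A : Set (TorsionClass C)} {x : TorsionClass C}

theorem hom_eq_zero (h : IsCanonicalJoinRep A x) {B B' : C} (hB' : IsBrick B') (hA : gen B ∈ A)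
    (hA' : gen B' ∈ A) (hne : gen B ≠ gen B') (f : B ⟶ B') : f = 0 := by
  have hperp : sSup (insert (lowerStar (gen B')) (A \ {gen B'})) ≤ perp (.singleton B') :=
    hB'.le_perp_of_lowerStar_le (le_sSup (Set.mem_insert _ _)) fun hmem =>
      h.not_le_sSup_insert_lowerStar hA' (gen_le.2 hmem)
  have hB : gen B ≤ sSup (insert (lowerStar (gen B')) (A \ {gen B'})) :=
    le_sSup (Set.mem_insert_of_mem _ ⟨hA, hne⟩)
  exact mem_perp_singleton.1 (gen_le.1 (hB.trans hperp)) f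

theorem exists_semibrick [∀ X : C, IsNoetherianObject X] [∀ X : C, IsArtinianObject X]
    (h : IsCanonicalJoinRep A x) :
    ∃ S : ObjectProperty C, IsSemibrick S ∧ torsionClosure S = x := by
  let S : ObjectProperty C := fun B => IsBrick B ∧ gen B ∈ A
  have hSA : gen '' {B | S B} = A := by
    refine subset_antisymm (Set.image_subset_iff.2 fun B hB => hB.2) fun a ha => ?_
    obtain ⟨B, hB, rfl⟩ := (h.isCompletelyJoinIrred ha).exists_brick
    exact ⟨B, ⟨hB, ha⟩, rfl⟩
  refine ⟨S, ⟨fun hB => hB.1.not_isZero, fun {B B'} f hB hB' hf => ?_⟩, ?_⟩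
  · refine hB.1.isIso_of_gen_eq hB'.1 ?_ hf
    by_contra hne
    exact hf (h.hom_eq_zero hB'.1 hB.2 hB'.2 hne f)
  · rw [← sSup_gen_image, hSA, h.sSup_eq]

end IsCanonicalJoinRep

end CanonicalJoins

section WideSubcategories

variable {C : Type u} [Category.{v} C] [Abelian C]

namespace TorsionClass

variable (T : TorsionClass C)

/-- The wide subcategory `α(T)` of Ingalls and Thomas: the objects `X` of `T` such that every
morphism from an object of `T` to `X` has its kernel in `T`. -/
def wideCore : ObjectProperty C :=
  fun X => T.obj X ∧ ∀ ⦃Y : C⦄ (f : Y ⟶ X), T.obj Y → T.obj (kernel f)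

instance : T.wideCore.IsClosedUnderIsomorphisms where
  of_iso e h := ⟨T.obj.prop_of_iso e h.1, fun _ f hY =>
    (prop_kernel_iff_of_comp_mono e.inv rfl).1 (h.2 (f ≫ e.inv) hY)⟩

instance : T.wideCore.ContainsZero where
  exists_zero := ⟨_, isZero_zero C, T.obj.prop_of_isZero (isZero_zero C), fun _ _ hY =>
    T.obj.prop_of_iso
      (kernelZeroIsoSource.symm ≪≫ kernelIsoOfEq ((isZero_zero C).eq_of_tgt 0 _)) hY⟩

instance : T.wideCore.IsClosedUnderKernels where
  kernels_le := by
    rintro _ ⟨f, k, hk, hX, hY⟩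
    refine T.wideCore.prop_of_iso (hk.conePointUniqueUpToIso (kernelIsKernel f)).symm
      ⟨hY.2 f hX.1, fun Z g hZ => ?_⟩
    exact (prop_kernel_iff_of_comp_mono (kernel.ι f) rfl).1 (hX.2 _ hZ)

instance : T.wideCore.IsClosedUnderCokernels where
  cokernels_le := by
    rintro _ ⟨f, k, hk, hX, hY⟩
    refine T.wideCore.prop_of_iso ((cokernelIsCokernel f).coconePointUniqueUpToIso hk)
      ⟨T.obj.prop_of_epi (cokernel.π f) hY.1, fun Z g hZ => ?_⟩
    have sq := IsPullback.of_hasPullback g (cokernel.π f)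
    have hP : T.obj (pullback g (cokernel.π f)) :=
      prop_of_epi_of_kernel (pullback.fst g (cokernel.π f))
        ((prop_kernel_iff_of_isPullback sq).2 (T.image_mem f hX.1)) hZ
    exact (prop_kernel_iff_of_isPullback sq.flip).1 (hY.2 _ hP)

instance : T.wideCore.IsClosedUnderExtensions where
  prop_X₂_of_shortExact {S} hS h₁ h₃ := by
    refine ⟨T.obj.prop_X₂_of_shortExact hS h₁.1 h₃.1, fun Z g hZ => ?_⟩
    have := hS.mono_f
    have hg : (kernel.ι (g ≫ S.g) ≫ g) ≫ S.g = 0 := by simp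
    have hK : T.obj (kernel (hS.exact.lift _ hg)) := h₁.2 _ (h₃.2 (g ≫ S.g) hZ)
    exact T.obj.prop_of_iso (kernelKernelCompIso g S.g)
      ((prop_kernel_iff_of_comp_mono S.f (hS.exact.lift_f _ hg)).2 hK)

/-- `T.wideCore` as a wide subcategory. -/
def wide : WideSubcat C where
  obj := T.wideCore
  closedUnderIsomorphisms := inferInstance
  containsZero := inferInstance
  closedUnderKernels := inferInstance
  closedUnderCokernels := inferInstance
  closedUnderExtensions := inferInstance

end TorsionClass

namespace IsSemibrick

variable {S : ObjectProperty C}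

theorem isZero_of_exact (hS : IsSemibrick S) {E : ShortComplex C} (hE : E.Exact) [Mono E.f]
    (h₁ : (torsionClosure S).obj.rightOrthogonal E.X₁) (h₂ : (torsionClosure S).obj E.X₂)
    (h₃ : S E.X₃) (hg : E.g ≠ 0) : IsZero E.X₁ := by
  have h0 : ¬IsZero E.X₂ := fun h => hg (h.eq_of_src _ _)
  obtain ⟨B, s, hB, hs⟩ := exists_ne_zero_of_mem_torsionClosure h₂ h0
  have hsg : s ≫ E.g ≠ 0 := by
    intro h
    have hlift : hE.lift s h = 0 := h₁ _ (le_torsionClosure S B hB)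
    exact hs (by rw [← hE.lift_f s h, hlift, zero_comp])
  have := hS.isIso _ hB h₃ hsg
  obtain ⟨r, hr⟩ := exists_retraction hE s
  have : Epi r := epi_of_epi_fac hr
  exact (IsZero.iff_id_eq_zero _).2 (h₁ _ ((torsionClosure S).obj.prop_of_epi r h₂))

variable [∀ X : C, IsNoetherianObject X]

theorem le_wideCore (hS : IsSemibrick S) : S ≤ (torsionClosure S).wideCore := by
  refine fun B hB => ⟨le_torsionClosure S B hB, fun Y f hY => ?_⟩
  by_cases hf : f = 0
  · subst hf
    exact (torsionClosure S).obj.prop_of_iso kernelZeroIsoSource.symm hY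
  refine (torsionClosure S).leftOrthogonal_rightOrthogonal_le _ fun F g hF => ?_
  -- Push `kernel f ⟶ Y` out along the image `q` of `g`: this makes the kernel torsion-free.
  let q := Abelian.factorThruImage g
  have sq := IsPushout.of_hasPushout (kernel.ι f) q
  let f' : pushout (kernel.ι f) q ⟶ B := pushout.desc f 0 (by simp)
  have hf' : f' ≠ 0 := fun h => hf (by
    rw [← pushout.inl_desc f 0 (by simp : kernel.ι f ≫ f = q ≫ 0)]
    exact (congrArg _ h).trans comp_zero)
  have hE := exact_of_isPushout (ShortComplex.exact_kernel f) sq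
    (pushout.inl_desc ..) (pushout.inr_desc f 0 (by simp))
  have hIF : (torsionClosure S).obj.rightOrthogonal (Abelian.image g) := fun X u hX =>
    zero_of_comp_mono (Abelian.image.ι g) (hF _ hX)
  have hI := hS.isZero_of_exact hE hIF
    ((torsionClosure S).obj.prop_of_epi (pushout.inl (kernel.ι f) q) hY) hB hf'
  by_contra hg
  exact not_isZero_image hg hI

theorem wideCore_le (hS : IsSemibrick S) {P : ObjectProperty C} [P.ContainsZero]
    [P.IsClosedUnderIsomorphisms] [P.IsClosedUnderExtensions] (hP : S ≤ P) :
    (torsionClosure S).wideCore ≤ P := by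
  refine le_of_forall_exists_mono fun X hX h0 => ?_
  obtain ⟨B, i, hB, hi⟩ := exists_ne_zero_of_mem_torsionClosure hX.1 h0
  have hK : (torsionClosure S).obj (kernel i) := hX.2 i (le_torsionClosure S B hB)
  have : Mono i := by
    refine Preadditive.mono_of_kernel_zero ?_
    by_contra hι
    have := hS.epi_of_ne_zero hK hB hι
    exact hi (by rw [← cancel_epi (kernel.ι i), kernel.condition, comp_zero])
  exact ⟨B, i, this, hS.not_isZero hB, hP B hB,
    (torsionClosure S).wideCore.prop_cokernel i (hS.le_wideCore B hB) hX⟩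

theorem torsionClosure_wide (hS : IsSemibrick S) :
    torsionClosure (torsionClosure S).wide.obj = torsionClosure S :=
  le_antisymm (torsionClosure_le.2 fun _ h => h.1)
    (torsionClosure_le.2 (hS.le_wideCore.trans (le_torsionClosure _)))

theorem wideCore_eq [∀ X : C, IsArtinianObject X] (hS : IsSemibrick S) :
    (torsionClosure S).wideCore =
      (torsionClosure S).obj ⊓ (lowerCore (torsionClosure S)).obj.rightOrthogonal := by
  refine le_antisymm (le_inf (fun _ h => h.1) (hS.wideCore_le ?_)) fun Y hY => ?_
  · rw [← TorsionClass.le_perp_iff, hS.lowerCore_torsionClosure]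
    exact inf_le_right
  induction Y using (wellFounded_isProperSubobject C).induction with
  | _ Y ih =>
    by_cases h0 : IsZero Y
    · exact (torsionClosure S).wideCore.prop_of_isZero h0
    obtain ⟨B, f, hB, hf⟩ : ∃ (B : C) (f : Y ⟶ B), S B ∧ f ≠ 0 := by
      by_contra! h
      refine h0 ((IsZero.iff_id_eq_zero Y).2 (hY.2 (𝟙 Y) ?_))
      rw [hS.lowerCore_torsionClosure]
      exact TorsionClass.mem_inf.2 ⟨hY.1, fun B f hB => h B f hB⟩
    have := hS.epi_of_ne_zero hY.1 hB hf
    have hBw := hS.le_wideCore B hB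
    refine prop_of_epi_of_kernel f (ih _ (isProperSubobject_kernel hf)
      ⟨hBw.2 f hY.1, fun X g hX => ?_⟩) hBw
    exact zero_of_comp_mono (kernel.ι f) (hY.2 _ hX)

end IsSemibrick

namespace WideSubcat

instance (W : WideSubcat C) : W.obj.IsClosedUnderIsomorphisms := W.closedUnderIsomorphisms
instance (W : WideSubcat C) : W.obj.ContainsZero := W.containsZero
instance (W : WideSubcat C) : W.obj.IsClosedUnderKernels := W.closedUnderKernels
instance (W : WideSubcat C) : W.obj.IsClosedUnderCokernels := W.closedUnderCokernels
instance (W : WideSubcat C) : W.obj.IsClosedUnderExtensions := W.closedUnderExtensions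

variable [∀ X : C, IsNoetherianObject X] [∀ X : C, IsArtinianObject X] (W : WideSubcat C)

theorem le_of_relativelySimple_le {P : ObjectProperty C} [P.ContainsZero]
    [P.IsClosedUnderIsomorphisms] [P.IsClosedUnderExtensions] (h : relativelySimple W.obj ≤ P) :
    W.obj ≤ P := by
  refine le_of_forall_exists_mono fun X hX h0 => ?_
  obtain ⟨B, i, _, hB⟩ := exists_mono_relativelySimple hX h0
  exact ⟨B, i, inferInstance, hB.2.1, h B hB, W.obj.prop_cokernel i hB.1 hX⟩

theorem torsionClosure_relativelySimple :
    torsionClosure (relativelySimple W.obj) = torsionClosure W.obj :=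
  le_antisymm (torsionClosure_le.2 fun _ hX => le_torsionClosure _ _ hX.1)
    (torsionClosure_le.2 (W.le_of_relativelySimple_le (le_torsionClosure _)))

theorem wideCore_torsionClosure : (torsionClosure W.obj).wideCore = W.obj := by
  rw [← W.torsionClosure_relativelySimple]
  exact le_antisymm (isSemibrick_relativelySimple.wideCore_le fun _ hX => hX.1)
    (W.le_of_relativelySimple_le isSemibrick_relativelySimple.le_wideCore)

theorem wide_torsionClosure : (torsionClosure W.obj).wide = W :=
  WideSubcat.obj_injective W.wideCore_torsionClosure

theorem obj_eq_inf_rightOrthogonal : W.obj = (torsionClosure W.obj).obj ⊓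
    (lowerCore (torsionClosure W.obj)).obj.rightOrthogonal := by
  have h := (isSemibrick_relativelySimple (P := W.obj)).wideCore_eq
  rwa [W.torsionClosure_relativelySimple, W.wideCore_torsionClosure] at h

theorem exists_isCanonicalJoinRep :
    ∃ A : Set (TorsionClass C), IsCanonicalJoinRep A (torsionClosure W.obj) :=
  ⟨_, W.torsionClosure_relativelySimple ▸ isSemibrick_relativelySimple.isCanonicalJoinRep⟩

end WideSubcat

end WideSubcategories

section CoreLabelOrder

variable {C : Type u} [Category.{v} C] [Abelian C]
  [∀ X : C, IsNoetherianObject X] [∀ X : C, IsArtinianObject X]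

open TorsionClass

theorem IsBrick.gen_mem_jlabel_iff {B : C} (hB : IsBrick B) (W : WideSubcat C) :
    gen B ∈ jlabel (lowerCore (torsionClosure W.obj)) (torsionClosure W.obj) ↔ W.obj B := by
  calc gen B ∈ jlabel (lowerCore (torsionClosure W.obj)) (torsionClosure W.obj)
    _ ↔ gen B ≤ torsionClosure W.obj ∧ lowerCore (torsionClosure W.obj) ≤ kappa (gen B) :=
      and_iff_right hB.isCompletelyJoinIrred_gen
    _ ↔ (torsionClosure W.obj).obj B ∧
        (lowerCore (torsionClosure W.obj)).obj.rightOrthogonal B := by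
      rw [gen_le, hB.kappa_gen, le_perp_singleton_iff]
    _ ↔ W.obj B := (iff_of_eq (congrFun W.obj_eq_inf_rightOrthogonal B)).symm

namespace WideSubcat

theorem le_iff_jlabel_subset (W₁ W₂ : WideSubcat C) :
    W₁ ≤ W₂ ↔ jlabel (lowerCore (torsionClosure W₁.obj)) (torsionClosure W₁.obj) ⊆
      jlabel (lowerCore (torsionClosure W₂.obj)) (torsionClosure W₂.obj) := by
  constructor
  · intro h j hj
    obtain ⟨B, hB, rfl⟩ := hj.1.exists_brick
    rw [hB.gen_mem_jlabel_iff] at hj ⊢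
    exact h B hj
  · refine fun h => W₁.le_of_relativelySimple_le fun B hB => ?_
    have hBrick : IsBrick B := isSemibrick_relativelySimple.isBrick hB
    exact (hBrick.gen_mem_jlabel_iff W₂).1 (h ((hBrick.gen_mem_jlabel_iff W₁).2 hB.1))

variable (C) in
/-- The bijection `W ↦ T(W)` from wide subcategories to torsion classes with a canonical join
representation, with inverse `T ↦ α(T)`. -/
def equivCJRElements : WideSubcat C ≃ CJRElements (TorsionClass C) where
  toFun W := ⟨torsionClosure W.obj, W.exists_isCanonicalJoinRep⟩
  invFun x := x.1.wide
  left_inv W := W.wide_torsionClosure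
  right_inv := by
    rintro ⟨x, A, hA⟩
    obtain ⟨S, hS, rfl⟩ := hA.exists_semibrick
    exact Subtype.ext hS.torsionClosure_wide

end WideSubcat

end CoreLabelOrder

theorem theorem4 {C : Type u} [Category.{v} C] [Abelian C]
    (hlength : ∀ X : C, HasCompositionSeries X) :
    (∀ j : TorsionClass C, IsCompletelyJoinIrred j →
      IsGreatest {x : TorsionClass C | j ⊓ x = lowerStar j} (kappa j)) ∧
    ∃ e : ((· ≤ ·) : WideSubcat C → WideSubcat C → Prop) ≃r
        (cloLE : CJRElements (TorsionClass C) → CJRElements (TorsionClass C) → Prop),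
      ∀ W : WideSubcat C, (e W).1 = torsionClosure W.obj := by
  have : ∀ X : C, IsNoetherianObject X := fun X => (hlength X).isNoetherianObject
  have : ∀ X : C, IsArtinianObject X := fun X => (hlength X).isArtinianObject
  exact ⟨fun j hj => hj.isGreatest_kappa, ⟨WideSubcat.equivCJRElements C,
    fun {W₁ W₂} => (W₁.le_iff_jlabel_subset W₂).symm⟩, fun _ => rfl⟩
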